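/- Time is slotted, with slots $t=1,2,\dots$. In each slot, independently, a source symbol arrives with probability $q\in(0,1]$. The successive symbols $X_1,X_2,\dots$ are i.i.d. with PMF $P_X$ on a finite alphabet $\mathcal X$ and are independent of the arrivals; each symbol is time-stamped with its arrival time. A prefix-free binary code $\mathcal E:\mathcal X\to\{0,1\}^*$ is given, $L=|\mathcal E(X)|$ denotes the codeword length of a symbol $X\sim P_X$, and $P_L$ is its distribution. On arrival of $X_k$ its codeword $\mathcal E(X_k)$ is appended to an initially empty FIFO buffer of infinite capacity; in each time unit $(t,t+1]$ the buffer outputs the first bit of its content at time $t$, which is received at time $t+1$ (if the buffer is empty at time $t$, the decoder is told so and receives no bit). A symbol is decoded as soon as its whole codeword and those of all earlier symbols have been received. For real $t\ge 0$ let $u(t)$ be the time stamp of the most recent symbol decoded by time $t$, with $u(t)=-\Delta_0$ for a fixed $\Delta_0\ge 0$ before the first symbol is decoded, and let $\Delta(t)=t-u(t)$ be the age. The age grows with slope one except for downward jumps; the $k$-th peak $\Delta_k$ is the left limit of $\Delta$ at its $k$-th downward jump. If the system is stable, that is, $\mathbb E[L]<1/q$, then almost surely there are infinitely many peaks and the average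 peak age of information exists and is given by $$\Delta^{P}=\lim_{K\to\infty}\frac1K\sum_{k=1}^{K}\Delta_k=\frac{\mathbb E[L^2]-\mathbb E[L]}{2\,(1/q-\mathbb E[L])}+\mathbb E[L]+\frac1q .$$ -/

import Mathlib

/-!
Sample-path description of the streaming source coding system.

Time is slotted. `a t` tells whether a source symbol arrives at the integer time `t` (slots start
at `t = 1`), `x k` is the `(k+1)`-st source symbol, and `c` is the code.
-/

namespace StreamCoding

/-- A binary code is prefix-free: no codeword is a prefix of the codeword of another symbol. -/
def PrefixFree {𝒳 : Type*} (c : 𝒳 → List Bool) : Prop :=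
  ∀ x y, c x <+: c y → x = y

/-- The moment `E[L ^ m]` of the codeword length `L = l(X)`, where `X` has PMF `P`. -/
noncomputable def lengthMoment {𝒳 : Type*} [Fintype 𝒳] (P : PMF 𝒳) (c : 𝒳 → List Bool)
    (m : ℕ) : ℝ :=
  ∑ x, (P x).toReal * ((c x).length : ℝ) ^ m

/-- A symbol arrives at time `t`. -/
def Arrival (a : ℕ → Bool) (t : ℕ) : Prop := 1 ≤ t ∧ a t = true

instance (a : ℕ → Bool) : DecidablePred (Arrival a) :=
  fun t => inferInstanceAs (Decidable (1 ≤ t ∧ a t = true))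

/-- `N(t)`: the number of symbols observed by the encoder by time `t` (inclusive). -/
def numArrivals (a : ℕ → Bool) (t : ℕ) : ℕ := Nat.count (Arrival a) (t + 1)

/-- The time stamp of the symbol `x k`. -/
noncomputable def timeStamp (a : ℕ → Bool) (k : ℕ) : ℕ := Nat.nth (Arrival a) k

/-- The concatenated codewords of the first `k` symbols. -/
def encodeFirst {𝒳 : Type*} (c : 𝒳 → List Bool) (x : ℕ → 𝒳) (k : ℕ) : List Bool :=
  ((List.range k).map fun i => c (x i)).flatten

/-- Content of the FIFO buffer at time `t`, just after the codeword of the symbol arriving at `t`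
(if there is one) has been appended. During `(t, t + 1]` the buffer outputs its first bit. -/
def buffer {𝒳 : Type*} (c : 𝒳 → List Bool) (a : ℕ → Bool) (x : ℕ → 𝒳) : ℕ → List Bool
  | 0 => []
  | t + 1 => (buffer c a x t).tail ++
      (if Arrival a (t + 1) then c (x (numArrivals a t)) else [])

/-- The bits that the decoder has received by time `t`. In a slot in which the buffer is empty no
bit is sent. -/
def received {𝒳 : Type*} (c : 𝒳 → List Bool) (a : ℕ → Bool) (x : ℕ → 𝒳) : ℕ → List Bool
  | 0 => []
  | t + 1 => received c a x t ++ (buffer c a x t).take 1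

/-- The number of symbols decoded by time `t`: the largest number `k` of arrived symbols such that
the codewords of the first `k` symbols have been received completely. -/
def numDecoded {𝒳 : Type*} (c : 𝒳 → List Bool) (a : ℕ → Bool) (x : ℕ → 𝒳) (t : ℕ) : ℕ :=
  Nat.findGreatest (fun k => encodeFirst c x k <+: received c a x t) (numArrivals a t)

/-- `u(t)`: the time stamp of the most recent symbol decoded by the (real) time `t`; before the
first symbol is decoded it is `-Δ₀`, so that the age starts from `Δ₀` at time `0`. -/
noncomputable def lastStamp {𝒳 : Type*} (Δ₀ : ℝ) (c : 𝒳 → List Bool) (a : ℕ → Bool)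
    (x : ℕ → 𝒳) (t : ℝ) : ℝ :=
  if numDecoded c a x ⌊t⌋₊ = 0 then -Δ₀
  else (timeStamp a (numDecoded c a x ⌊t⌋₊ - 1) : ℝ)

/-- The age process `Δ(t) = t - u(t)`. -/
noncomputable def age {𝒳 : Type*} (Δ₀ : ℝ) (c : 𝒳 → List Bool) (a : ℕ → Bool)
    (x : ℕ → 𝒳) (t : ℝ) : ℝ :=
  t - lastStamp Δ₀ c a x t

/-- The age process peaks at time `n`: it drops there, from its left limit to a smaller value.
(The age grows with slope one between integer times, so that it drops only at integer times.) -/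
def IsPeakTime {𝒳 : Type*} (Δ₀ : ℝ) (c : 𝒳 → List Bool) (a : ℕ → Bool) (x : ℕ → 𝒳)
    (n : ℕ) : Prop :=
  age Δ₀ c a x n < Function.leftLim (age Δ₀ c a x) n

/-- The value of the `(k+1)`-st peak of the age process: its left limit at the `(k+1)`-st
peak time. -/
noncomputable def peakAge {𝒳 : Type*} (Δ₀ : ℝ) (c : 𝒳 → List Bool) (a : ℕ → Bool)
    (x : ℕ → 𝒳) (k : ℕ) : ℝ :=
  Function.leftLim (age Δ₀ c a x) (Nat.nth (IsPeakTime Δ₀ c a x) k : ℕ)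

end StreamCoding

/-!
A symbol that finds `n` bits in the FIFO buffer, its own codeword included, is decoded `n` time
units after its arrival. Decoding times are distinct, so the `k`-th peak occurs when symbol `k` is
decoded, and its value is that time minus the stamp of symbol `k - 1`. The stamps telescope: the
average peak age is the average of the buffer length at arrivals plus the mean interarrival time
`1 / q`.

The backlog satisfies `B (t + 1) = B t + S t - 1` (zero if idle), where `S t` is the number of bits
appended in slot `t`. The codeword used in an active slot is the next one of the source; giving an
idle slot a dummy symbol does not change `S`, and it makes the pairs (activity, `S`) a function of
i.i.d. data, hence i.i.d. Expanding `B (t + 1) ^ 2 + B (t + 1)` and summing over `t` expresses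
`∑ B t * (1 - S t)` through `∑ (S t ^ 2 - S t)`. Since `B t` depends only on the past of slot `t`,
the increments `B t * (ψ t - 𝔼[ψ t])`, for any function `ψ t` of the slot, are orthogonal; stability
gives an exponential moment of `B t` that is bounded in `t`, so their averages vanish almost surely.
Taking `ψ = S` yields the stationary mean of `B`, and taking `ψ` to be the activity yields its
average at arrivals.
-/

open Filter Topology MeasureTheory ProbabilityTheory

namespace StreamCoding

section SamplePath

variable {𝒳 : Type*} (c : 𝒳 → List Bool) (a : ℕ → Bool) (x : ℕ → 𝒳)

theorem numArrivals_zero : numArrivals a 0 = 0 := by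
  simp [numArrivals, Nat.count_succ, Arrival]

theorem numArrivals_succ (t : ℕ) :
    numArrivals a (t + 1) = numArrivals a t + if Arrival a (t + 1) then 1 else 0 := by
  rw [numArrivals, Nat.count_succ]; rfl

theorem encodeFirst_succ (k : ℕ) : encodeFirst c x (k + 1) = encodeFirst c x k ++ c (x k) := by
  simp [encodeFirst, List.range_succ]

theorem encodeFirst_prefix {j k : ℕ} (h : j ≤ k) : encodeFirst c x j <+: encodeFirst c x k := by
  induction k, h using Nat.le_induction with
  | base => exact List.prefix_rfl
  | succ k _ ih => exact ih.trans (by rw [encodeFirst_succ]; exact List.prefix_append _ _)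

theorem received_append_buffer (t : ℕ) :
    received c a x t ++ buffer c a x t = encodeFirst c x (numArrivals a t) := by
  induction t with
  | zero => simp [received, buffer, numArrivals_zero, encodeFirst]
  | succ t ih =>
    have take_append_tail :
        (buffer c a x t).take 1 ++ (buffer c a x t).tail = buffer c a x t := by
      rw [← List.drop_one, List.take_append_drop]
    rw [received, buffer, List.append_assoc, ← List.append_assoc (List.take 1 _),
      take_append_tail, ← List.append_assoc, ih, numArrivals_succ]
    split_ifs
    · rw [encodeFirst_succ]
    · simp

theorem length_received_succ (t : ℕ) : (received c a x (t + 1)).length =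
    (received c a x t).length + min 1 (buffer c a x t).length := by
  simp [received]

theorem length_received_mono : Monotone fun t => (received c a x t).length :=
  monotone_nat_of_le_succ fun t => by
    rw [length_received_succ]; exact Nat.le_add_right _ _

theorem length_buffer_succ (t : ℕ) : (buffer c a x (t + 1)).length =
    (buffer c a x t).length - 1 +
      if Arrival a (t + 1) then (c (x (numArrivals a t))).length else 0 := by
  rw [buffer]; split_ifs <;> simp

theorem length_buffer_le_add (s j : ℕ) :
    (buffer c a x s).length ≤ (buffer c a x (s + j)).length + j := by
  induction j with
  | zero => simp
  | succ j ih =>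
    have := length_buffer_succ c a x (s + j)
    rw [← add_assoc s]; omega

theorem length_received_add {s j : ℕ} (h : j ≤ (buffer c a x s).length) :
    (received c a x (s + j)).length = (received c a x s).length + j := by
  induction j with
  | zero => simp
  | succ j ih =>
    have := length_buffer_le_add c a x s j
    rw [← add_assoc, length_received_succ, ih (by omega)]; omega

theorem encodeFirst_prefix_received_iff {k t : ℕ} (hk : k ≤ numArrivals a t) :
    encodeFirst c x k <+: received c a x t ↔
      (encodeFirst c x k).length ≤ (received c a x t).length := by
  refine ⟨List.IsPrefix.length_le, List.prefix_of_prefix_length_le (encodeFirst_prefix c x hk) ?_⟩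
  rw [← received_append_buffer c a x t]; exact List.prefix_append _ _

theorem lt_numDecoded_iff {k t : ℕ} : k < numDecoded c a x t ↔
    k < numArrivals a t ∧ (encodeFirst c x (k + 1)).length ≤ (received c a x t).length := by
  constructor
  · intro h
    have le_arrivals : numDecoded c a x t ≤ numArrivals a t := Nat.findGreatest_le _
    have decoded_prefix : encodeFirst c x (numDecoded c a x t) <+: received c a x t :=
      Nat.findGreatest_spec (P := fun k => encodeFirst c x k <+: received c a x t) (m := 0)
        (Nat.zero_le _) (by simp [encodeFirst])
    exact ⟨h.trans_le le_arrivals,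
      (encodeFirst_prefix c x h).length_le.trans decoded_prefix.length_le⟩
  · rintro ⟨hk, hlen⟩
    exact Nat.le_findGreatest (P := fun k => encodeFirst c x k <+: received c a x t) hk
      ((encodeFirst_prefix_received_iff c a x hk).2 hlen)

/-- The time at which the symbol `x k` is decoded: since the buffer is FIFO, this is when all bits
present at the arrival of `x k` have been sent. -/
noncomputable def decodeTime (k : ℕ) : ℕ :=
  timeStamp a k + (buffer c a x (timeStamp a k)).length

/-- The time stamp that the decoder displays once it has decoded `k` symbols, with the convention
of `lastStamp` for `k = 0`. -/
noncomputable def stampAfter (Δ₀ : ℝ) (a : ℕ → Bool) : ℕ → ℝ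
  | 0 => -Δ₀
  | k + 1 => timeStamp a k

theorem lastStamp_eq_stampAfter (Δ₀ t : ℝ) :
    lastStamp Δ₀ c a x t = stampAfter Δ₀ a (numDecoded c a x ⌊t⌋₊) := by
  rw [lastStamp]
  cases numDecoded c a x ⌊t⌋₊ <;> simp [stampAfter]

/-- The truncated subtraction makes the formula hold at `n = 0` too, where it is the limit of
`t + Δ₀`, because negative times are rounded up to `0` by `⌊t⌋₊`. -/
theorem leftLim_age (Δ₀ : ℝ) (n : ℕ) : Function.leftLim (age Δ₀ c a x) n =
    n - stampAfter Δ₀ a (numDecoded c a x (n - 1)) := by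
  refine leftLim_eq_of_tendsto ?_
  have floor_eq : ∀ᶠ t : ℝ in 𝓝[<] (n : ℝ), ⌊t⌋₊ = n - 1 := by
    filter_upwards [Ioo_mem_nhdsLT (sub_one_lt (n : ℝ))] with t ht
    rcases n with _ | n
    · exact Nat.floor_of_nonpos (by simpa using ht.2.le)
    · push_cast at ht
      rw [add_sub_cancel_right] at ht
      exact (Nat.floor_eq_iff ((Nat.cast_nonneg n).trans ht.1.le)).2 ⟨ht.1.le, by simpa using ht.2⟩
  refine Tendsto.congr' (f₁ := fun t => t - stampAfter Δ₀ a (numDecoded c a x (n - 1))) ?_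
    ((Continuous.tendsto (by fun_prop) _).mono_left nhdsWithin_le_nhds)
  filter_upwards [floor_eq] with t ht
  rw [age, lastStamp_eq_stampAfter, ht]

theorem isPeakTime_iff_stampAfter_lt (Δ₀ : ℝ) (n : ℕ) : IsPeakTime Δ₀ c a x n ↔
    stampAfter Δ₀ a (numDecoded c a x (n - 1)) < stampAfter Δ₀ a (numDecoded c a x n) := by
  rw [IsPeakTime, leftLim_age, age, lastStamp_eq_stampAfter, Nat.floor_natCast,
    sub_lt_sub_iff_left]

theorem sum_ite_arrival (f : ℕ → ℝ) (T : ℕ) :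
    ∑ t ∈ Finset.range T, (if Arrival a (t + 1) then f (t + 1) else 0) =
      ∑ k ∈ Finset.range (numArrivals a T), f (timeStamp a k) := by
  induction T with
  | zero => simp [numArrivals_zero]
  | succ T ih =>
    rw [Finset.sum_range_succ, ih, numArrivals_succ]
    split_ifs with h
    · rw [Finset.sum_range_succ]
      congr 2
      exact (Nat.nth_count h).symm
    · simp

variable {a}

theorem infinite_arrival_of_tendsto {q : ℝ} (hq : 0 < q)
    (hN : Tendsto (fun T : ℕ => (numArrivals a T : ℝ) / T) atTop (𝓝 q)) :
    {t | Arrival a t}.Infinite := by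
  intro hfin
  have numArrivals_le (T : ℕ) : numArrivals a T ≤ hfin.toFinset.card := by
    rw [numArrivals, Nat.count_eq_card_filter_range]
    exact Finset.card_le_card fun t ht => by simpa using (Finset.mem_filter.1 ht).2
  have rate_zero : Tendsto (fun T : ℕ => (numArrivals a T : ℝ) / T) atTop (𝓝 0) := by
    refine squeeze_zero (fun T => by positivity) (fun T => ?_)
      (tendsto_const_div_atTop_nhds_zero_nat (hfin.toFinset.card : ℝ))
    gcongr
    exact numArrivals_le T
  exact hq.ne (tendsto_nhds_unique rate_zero hN)

variable (ha : {t | Arrival a t}.Infinite)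

include ha

theorem arrival_timeStamp (k : ℕ) : Arrival a (timeStamp a k) := Nat.nth_mem_of_infinite ha k

theorem timeStamp_strictMono : StrictMono (timeStamp a) := Nat.nth_strictMono ha

theorem numArrivals_timeStamp (k : ℕ) : numArrivals a (timeStamp a k) = k + 1 :=
  Nat.count_nth_succ_of_infinite ha k

theorem lt_numArrivals_iff {k t : ℕ} : k < numArrivals a t ↔ timeStamp a k ≤ t := by
  rw [← not_le, numArrivals, Nat.count_le_iff_le_nth ha, not_le, Nat.lt_succ_iff, timeStamp]

theorem stampAfter_strictMono {Δ₀ : ℝ} (hΔ₀ : 0 ≤ Δ₀) : StrictMono (stampAfter Δ₀ a) := by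
  refine strictMono_nat_of_lt_succ fun k => ?_
  rcases k with _ | k
  · have timeStamp_pos : (0 : ℝ) < timeStamp a 0 := by exact_mod_cast (arrival_timeStamp ha 0).1
    exact (neg_nonpos.2 hΔ₀).trans_lt timeStamp_pos
  · exact Nat.cast_lt.2 (timeStamp_strictMono ha k.lt_succ_self)

theorem decodeTime_pos (k : ℕ) : 0 < decodeTime c a x k :=
  (arrival_timeStamp ha k).1.trans (Nat.le_add_right _ _)

theorem length_received_decodeTime (k : ℕ) :
    (received c a x (decodeTime c a x k)).length = (encodeFirst c x (k + 1)).length := by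
  rw [decodeTime, length_received_add c a x le_rfl, ← numArrivals_timeStamp ha k,
    ← received_append_buffer c a x, List.length_append]

theorem lt_numDecoded_iff_decodeTime_le {k t : ℕ} :
    k < numDecoded c a x t ↔ decodeTime c a x k ≤ t := by
  rw [lt_numDecoded_iff, lt_numArrivals_iff ha, ← length_received_decodeTime c x ha]
  constructor
  · rintro ⟨arrived, hlen⟩
    obtain ⟨j, rfl⟩ := Nat.exists_eq_add_of_le arrived
    by_contra! early
    rw [decodeTime] at early hlen
    rw [length_received_add c a x le_rfl, length_received_add c a x (by omega)] at hlen
    omega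
  · exact fun h => ⟨(Nat.le_add_right _ _).trans h, length_received_mono c a x h⟩

theorem isPeakTime_iff {Δ₀ : ℝ} (hΔ₀ : 0 ≤ Δ₀) (n : ℕ) :
    IsPeakTime Δ₀ c a x n ↔ ∃ k, decodeTime c a x k = n := by
  rw [isPeakTime_iff_stampAfter_lt, (stampAfter_strictMono ha hΔ₀).lt_iff_lt]
  have decoded_iff (k t : ℕ) := lt_numDecoded_iff_decodeTime_le c x ha (k := k) (t := t)
  constructor
  · intro h
    refine ⟨numDecoded c a x (n - 1), ?_⟩
    have := decoded_iff (numDecoded c a x (n - 1)) (n - 1)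
    have := decoded_iff (numDecoded c a x (n - 1)) n
    omega
  · rintro ⟨k, hk⟩
    have := decodeTime_pos c x ha k
    have := decoded_iff k (n - 1)
    have := decoded_iff k n
    omega

variable (hc : ∀ y z, c y = [] → c z = [])

include hc

theorem decodeTime_strictMono : StrictMono (decodeTime c a x) := by
  refine strictMono_nat_of_lt_succ fun k => ?_
  by_cases hempty : c (x (k + 1)) = []
  · have all_empty (y : 𝒳) : c y = [] := hc _ y hempty
    have buffer_empty (t : ℕ) : (buffer c a x t).length = 0 := by
      induction t with
      | zero => rfl
      | succ t ih => simp [length_buffer_succ, ih, all_empty]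
    simpa [decodeTime, buffer_empty] using timeStamp_strictMono ha k.lt_succ_self
  · by_contra! h
    have hlen := length_received_mono c a x h
    simp only [length_received_decodeTime c x ha, encodeFirst_succ c x (k + 1),
      List.length_append] at hlen
    have := List.length_pos_iff.2 hempty
    omega

theorem numDecoded_decodeTime_sub_one (k : ℕ) :
    numDecoded c a x (decodeTime c a x k - 1) = k := by
  refine eq_of_forall_lt_iff fun j => ?_
  rw [lt_numDecoded_iff_decodeTime_le c x ha, Nat.le_sub_one_iff_lt (decodeTime_pos c x ha k),
    (decodeTime_strictMono c x ha hc).lt_iff_lt]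

variable {Δ₀ : ℝ} (hΔ₀ : 0 ≤ Δ₀)

include hΔ₀

theorem infinite_isPeakTime : {n | IsPeakTime Δ₀ c a x n}.Infinite := by
  simp only [isPeakTime_iff c x ha hΔ₀]
  exact Set.infinite_range_of_injective (decodeTime_strictMono c x ha hc).injective

theorem nth_isPeakTime (k : ℕ) : Nat.nth (IsPeakTime Δ₀ c a x) k = decodeTime c a x k := by
  have peak_iff := isPeakTime_iff c x ha hΔ₀
  rw [← Nat.nth_comp_of_strictMono (n := k) (decodeTime_strictMono c x ha hc)
      (fun n hn => (peak_iff n).1 hn) (absurd · (infinite_isPeakTime c x ha hc hΔ₀)),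
    Nat.nth_of_forall fun n _ => (peak_iff _).2 ⟨n, rfl⟩]

theorem peakAge_eq (k : ℕ) : peakAge Δ₀ c a x k = decodeTime c a x k - stampAfter Δ₀ a k := by
  rw [peakAge, nth_isPeakTime c x ha hc hΔ₀, leftLim_age,
    numDecoded_decodeTime_sub_one c x ha hc]

theorem sum_peakAge (K : ℕ) : ∑ k ∈ Finset.range K, peakAge Δ₀ c a x k =
    ∑ k ∈ Finset.range K, ((buffer c a x (timeStamp a k)).length : ℝ)
      + (stampAfter Δ₀ a K + Δ₀) := by
  have telescope : stampAfter Δ₀ a K + Δ₀ =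
      ∑ k ∈ Finset.range K, (stampAfter Δ₀ a (k + 1) - stampAfter Δ₀ a k) := by
    rw [Finset.sum_range_sub, stampAfter, sub_neg_eq_add]
  rw [telescope, ← Finset.sum_add_distrib]
  refine Finset.sum_congr rfl fun k _ => ?_
  rw [peakAge_eq c x ha hc hΔ₀, decodeTime, stampAfter]
  push_cast
  ring

theorem tendsto_average_peakAge {q g : ℝ} (hq : 0 < q)
    (hN : Tendsto (fun T : ℕ => (numArrivals a T : ℝ) / T) atTop (𝓝 q))
    (hG : Tendsto (fun T : ℕ => (∑ t ∈ Finset.range T,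
      if Arrival a (t + 1) then ((buffer c a x (t + 1)).length : ℝ) else 0) / T) atTop (𝓝 g)) :
    Tendsto (fun K : ℕ => (1 / (K : ℝ)) * ∑ k ∈ Finset.range K, peakAge Δ₀ c a x k) atTop
      (𝓝 ((g + 1) / q)) := by
  refine (tendsto_add_atTop_iff_nat 1).1 ?_
  have hS : Tendsto (timeStamp a) atTop atTop := (timeStamp_strictMono ha).tendsto_atTop
  have initial_age : Tendsto (fun K => Δ₀ / (timeStamp a K : ℝ)) atTop (𝓝 0) :=
    (tendsto_const_div_atTop_nhds_zero_nat Δ₀).comp hS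
  have ratio := (((hG.comp hS).add_const 1).add initial_age).div (hN.comp hS) hq.ne'
  rw [add_zero] at ratio
  refine ratio.congr fun K => ?_
  have timeStamp_pos : (0 : ℝ) < timeStamp a K := by exact_mod_cast (arrival_timeStamp ha K).1
  have sum_buffer := sum_ite_arrival a (fun t => ((buffer c a x t).length : ℝ))
  simp only [Function.comp, Pi.div_apply]
  rw [sum_buffer, numArrivals_timeStamp ha, sum_peakAge c x ha hc hΔ₀, stampAfter]
  push_cast
  field_simp
  ring

end SamplePath

section OrthogonalSums

theorem tendsto_average_of_tendsto_sq {D : ℕ → ℝ}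
    (hsq : Tendsto (fun n : ℕ => (∑ t ∈ Finset.range (n ^ 2), D t) / n ^ 2) atTop (𝓝 0))
    (hblock : Tendsto (fun n : ℕ => (∑ t ∈ Finset.Ico (n ^ 2) ((n + 1) ^ 2), |D t|) / n ^ 2)
      atTop (𝓝 0)) :
    Tendsto (fun T : ℕ => (∑ t ∈ Finset.range T, D t) / T) atTop (𝓝 0) := by
  have sqrt_atTop : Tendsto Nat.sqrt atTop atTop :=
    tendsto_atTop.2 fun b => (eventually_ge_atTop (b ^ 2)).mono fun T hT => Nat.le_sqrt'.2 hT
  refine squeeze_zero_norm' ?_ (by simpa using (hsq.abs.add hblock).comp sqrt_atTop)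
  filter_upwards [eventually_gt_atTop 0] with T hT
  set n := T.sqrt
  have sq_le : n ^ 2 ≤ T := T.sqrt_le'
  have lt_sq : T < (n + 1) ^ 2 := T.lt_succ_sqrt'
  have : (0 : ℝ) < n := Nat.cast_pos.2 (Nat.sqrt_pos.2 hT)
  have abs_sum_Ico_le : |∑ t ∈ Finset.Ico (n ^ 2) T, D t| ≤
      ∑ t ∈ Finset.Ico (n ^ 2) ((n + 1) ^ 2), |D t| :=
    (Finset.abs_sum_le_sum_abs _ _).trans (Finset.sum_le_sum_of_subset_of_nonneg
      (Finset.Ico_subset_Ico_right lt_sq.le) fun _ _ _ => abs_nonneg _)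
  calc ‖(∑ t ∈ Finset.range T, D t) / T‖
      = |∑ t ∈ Finset.range (n ^ 2), D t + ∑ t ∈ Finset.Ico (n ^ 2) T, D t| / T := by
        rw [Finset.sum_range_add_sum_Ico D sq_le, Real.norm_eq_abs, abs_div, Nat.abs_cast]
    _ ≤ (|∑ t ∈ Finset.range (n ^ 2), D t| + ∑ t ∈ Finset.Ico (n ^ 2) ((n + 1) ^ 2), |D t|)
          / n ^ 2 := by
        gcongr
        · exact (abs_add_le _ _).trans (by gcongr)
        · exact_mod_cast sq_le
    _ = |(∑ t ∈ Finset.range (n ^ 2), D t) / n ^ 2| +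
          (∑ t ∈ Finset.Ico (n ^ 2) ((n + 1) ^ 2), |D t|) / n ^ 2 := by
        rw [add_div, abs_div, abs_of_nonneg (sq_nonneg (n : ℝ))]

variable {Ω : Type*} [MeasurableSpace Ω] {μ : Measure Ω}

theorem ae_tendsto_zero_of_summable_integral {f : ℕ → Ω → ℝ} (hf0 : ∀ n ω, 0 ≤ f n ω)
    (hf : ∀ n, Integrable (f n) μ) (hsum : Summable fun n => ∫ ω, f n ω ∂μ) :
    ∀ᵐ ω ∂μ, Tendsto (fun n => f n ω) atTop (𝓝 0) := by
  have hmeas (n : ℕ) := (hf n).aestronglyMeasurable.aemeasurable.ennreal_ofReal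
  have lintegral_tsum_ne_top : ∫⁻ ω, ∑' n, ENNReal.ofReal (f n ω) ∂μ ≠ ⊤ := by
    simp_rw [lintegral_tsum hmeas,
      ← ofReal_integral_eq_lintegral_ofReal (hf _) (ae_of_all _ (hf0 _)),
      ← ENNReal.ofReal_tsum_of_nonneg (fun n => integral_nonneg (hf0 n)) hsum]
    exact ENNReal.ofReal_ne_top
  filter_upwards [ae_lt_top' (AEMeasurable.tsum hmeas) lintegral_tsum_ne_top] with ω hω
  have tendsto_ofReal := ENNReal.tendsto_atTop_zero_of_tsum_ne_top hω.ne
  simpa [Function.comp_def, ENNReal.toReal_ofReal (hf0 _ _)] using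
    (ENNReal.tendsto_toReal ENNReal.zero_ne_top).comp tendsto_ofReal

theorem ae_tendsto_zero_of_integral_sq_le {f : ℕ → Ω → ℝ} (hf : ∀ n, MemLp (f n) 2 μ) {C : ℝ}
    (hC : ∀ n : ℕ, ∫ ω, f n ω ^ 2 ∂μ ≤ C / n ^ 2) :
    ∀ᵐ ω ∂μ, Tendsto (fun n => f n ω) atTop (𝓝 0) := by
  have summable_integral : Summable fun n => ∫ ω, f n ω ^ 2 ∂μ := by
    refine Summable.of_nonneg_of_le (fun n => integral_nonneg fun ω => sq_nonneg _) hC ?_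
    simpa only [mul_one_div] using (Real.summable_one_div_nat_pow.2 one_lt_two).mul_left C
  filter_upwards [ae_tendsto_zero_of_summable_integral (fun n ω => sq_nonneg (f n ω))
    (fun n => (hf n).integrable_sq) summable_integral] with ω hω
  refine (tendsto_zero_iff_abs_tendsto_zero _).2 ?_
  simpa [Function.comp_def, Real.sqrt_sq_eq_abs] using (Real.continuous_sqrt.tendsto 0).comp hω

theorem ae_tendsto_div_sq_of_integral_sq_le {f : ℕ → Ω → ℝ} (hf : ∀ n, MemLp (f n) 2 μ) {C : ℝ}
    (hC : ∀ n : ℕ, n ≠ 0 → ∫ ω, f n ω ^ 2 ∂μ ≤ C * n ^ 2) :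
    ∀ᵐ ω ∂μ, Tendsto (fun n : ℕ => f n ω / n ^ 2) atTop (𝓝 0) := by
  refine ae_tendsto_zero_of_integral_sq_le (C := C) (fun n => ?_) fun n => ?_
  · simpa only [div_eq_mul_inv, mul_comm] using (hf n).const_mul ((n : ℝ) ^ 2)⁻¹
  · rcases eq_or_ne n 0 with rfl | hn
    · simp
    · simp_rw [div_pow, integral_div]
      rw [div_le_div_iff₀ (by positivity) (by positivity)]
      calc (∫ ω, f n ω ^ 2 ∂μ) * n ^ 2 ≤ (C * n ^ 2) * n ^ 2 := by gcongr; exact hC n hn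
        _ = C * (n ^ 2) ^ 2 := by ring

variable {D : ℕ → Ω → ℝ} (hD : ∀ t, MemLp (D t) 2 μ)

include hD

theorem integral_sq_sum_range_le (horth : ∀ s t, s < t → ∫ ω, D s ω * D t ω ∂μ = 0)
    {C : ℝ} (hC : ∀ t, ∫ ω, D t ω ^ 2 ∂μ ≤ C) (T : ℕ) :
    ∫ ω, (∑ t ∈ Finset.range T, D t ω) ^ 2 ∂μ ≤ T * C := by
  have hint (s t : ℕ) : Integrable (fun ω => D s ω * D t ω) μ := (hD s).integrable_mul (hD t)
  have horth' (s t : ℕ) (hst : s ≠ t) : ∫ ω, D s ω * D t ω ∂μ = 0 := by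
    rcases hst.lt_or_gt with h | h
    · exact horth s t h
    · simpa only [mul_comm] using horth t s h
  calc ∫ ω, (∑ t ∈ Finset.range T, D t ω) ^ 2 ∂μ
      = ∑ s ∈ Finset.range T, ∑ t ∈ Finset.range T, ∫ ω, D s ω * D t ω ∂μ := by
        simp_rw [sq, Finset.sum_mul_sum]
        rw [integral_finsetSum _ fun s _ => integrable_finsetSum _ fun t _ => hint s t]
        exact Finset.sum_congr rfl fun s _ => integral_finsetSum _ fun t _ => hint s t
    _ = ∑ s ∈ Finset.range T, ∫ ω, D s ω ^ 2 ∂μ := by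
        refine Finset.sum_congr rfl fun s hs => ?_
        rw [Finset.sum_eq_single_of_mem s hs fun t _ ht => horth' s t ht.symm]
        simp_rw [sq]
    _ ≤ T * C := by
        simpa using Finset.sum_le_card_nsmul (Finset.range T) _ C fun s _ => hC s

theorem integral_sq_sum_abs_le {C : ℝ} (hC : ∀ t, ∫ ω, D t ω ^ 2 ∂μ ≤ C) (I : Finset ℕ) :
    ∫ ω, (∑ t ∈ I, |D t ω|) ^ 2 ∂μ ≤ (I.card : ℝ) ^ 2 * C := by
  calc ∫ ω, (∑ t ∈ I, |D t ω|) ^ 2 ∂μ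
      ≤ ∫ ω, I.card * ∑ t ∈ I, D t ω ^ 2 ∂μ := by
        refine integral_mono (memLp_finsetSum I fun t _ => (hD t).abs).integrable_sq
          ((integrable_finsetSum I fun t _ => (hD t).integrable_sq).const_mul _) fun ω => ?_
        simpa using sq_sum_le_card_mul_sum_sq (s := I) (f := fun t => |D t ω|)
    _ = I.card * ∑ t ∈ I, ∫ ω, D t ω ^ 2 ∂μ := by
        rw [integral_const_mul, integral_finsetSum _ fun t _ => (hD t).integrable_sq]
    _ ≤ I.card * (I.card * C) := by
        gcongr
        simpa using Finset.sum_le_card_nsmul I _ C fun t _ => hC t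
    _ = (I.card : ℝ) ^ 2 * C := by ring

theorem ae_tendsto_average_of_orthogonal (horth : ∀ s t, s < t → ∫ ω, D s ω * D t ω ∂μ = 0)
    {C : ℝ} (hC : ∀ t, ∫ ω, D t ω ^ 2 ∂μ ≤ C) :
    ∀ᵐ ω ∂μ, Tendsto (fun T : ℕ => (∑ t ∈ Finset.range T, D t ω) / T) atTop (𝓝 0) := by
  have C_nonneg : 0 ≤ C := (integral_nonneg fun ω => sq_nonneg _).trans (hC 0)
  have squares := ae_tendsto_div_sq_of_integral_sq_le (C := C)
    (f := fun n ω => ∑ t ∈ Finset.range (n ^ 2), D t ω)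
    (fun n => memLp_finsetSum _ fun t _ => hD t) fun n _ =>
      (integral_sq_sum_range_le hD horth hC (n ^ 2)).trans_eq (by push_cast; ring)
  have blocks := ae_tendsto_div_sq_of_integral_sq_le (C := 9 * C)
    (f := fun n ω => ∑ t ∈ Finset.Ico (n ^ 2) ((n + 1) ^ 2), |D t ω|)
    (fun n => memLp_finsetSum _ fun t _ => (hD t).abs) fun n hn => by
      have block_card : (n + 1) ^ 2 - n ^ 2 ≤ 3 * n := by
        have := Nat.pos_of_ne_zero hn
        rw [Nat.sub_le_iff_le_add]; linarith
      calc _ ≤ ((Finset.Ico (n ^ 2) ((n + 1) ^ 2)).card : ℝ) ^ 2 * C :=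
            integral_sq_sum_abs_le hD hC _
        _ ≤ ((3 * n : ℕ) : ℝ) ^ 2 * C := by rw [Nat.card_Ico]; gcongr
        _ = 9 * C * n ^ 2 := by push_cast; ring
  filter_upwards [squares, blocks] with ω hsq hblock
  exact tendsto_average_of_tendsto_sq hsq hblock

end OrthogonalSums

section Backlog

/-- The backlog just before slot `t` of a queue that starts empty, receives `s t` units of work at
the start of slot `t` and serves one unit per slot. -/
def backlog (s : ℕ → ℕ) : ℕ → ℕ
  | 0 => 0
  | t + 1 => backlog s t + s t - 1

variable (s : ℕ → ℕ)

theorem sq_add_backlog_eq_sum (T : ℕ) : (backlog s T : ℝ) ^ 2 + backlog s T =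
    ∑ t ∈ Finset.range T, (2 * (backlog s t * (s t - 1)) + (s t ^ 2 - s t) : ℝ) := by
  induction T with
  | zero => simp [backlog]
  | succ T ih =>
    rw [Finset.sum_range_succ, ← ih, backlog]
    -- An idle slot has `backlog s T + s T = 0`, where both sides of the one-step identity vanish.
    rcases Nat.eq_zero_or_pos (backlog s T + s T) with h | h
    · obtain ⟨hb, hs⟩ := Nat.add_eq_zero_iff.1 h
      simp [hb, hs]
    · rw [Nat.cast_sub h]
      push_cast
      ring

theorem exp_backlog_succ_le (θ : ℝ) (t : ℕ) : Real.exp (θ * backlog s (t + 1)) ≤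
    Real.exp (-θ) * (Real.exp (θ * backlog s t) * Real.exp (θ * s t)) + 1 := by
  rw [backlog]
  rcases Nat.eq_zero_or_pos (backlog s t + s t) with h | h
  · rw [h]
    simpa using by positivity
  · rw [Nat.cast_sub h, ← Real.exp_add, ← Real.exp_add]
    refine le_add_of_le_of_nonneg (Real.exp_le_exp.2 (le_of_eq ?_)) zero_le_one
    push_cast
    ring

end Backlog

theorem pow_le_factorial_div_mul_exp {θ x : ℝ} (hθ : 0 < θ) (hx : 0 ≤ x) (k : ℕ) :
    x ^ k ≤ k.factorial / θ ^ k * Real.exp (θ * x) := by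
  have := Real.pow_div_factorial_le_exp (θ * x) (mul_nonneg hθ.le hx) k
  rw [div_le_iff₀ (by positivity), mul_pow] at this
  rw [div_mul_eq_mul_div, le_div_iff₀ (by positivity)]
  linarith

theorem exists_mgf_lt_exp_mul {Ω : Type*} [MeasurableSpace Ω] {μ : Measure Ω}
    [IsProbabilityMeasure μ] {X : Ω → ℝ} (hX : 0 ∈ interior (integrableExpSet X μ)) {b : ℝ}
    (hb : μ[X] < b) : ∃ θ > 0, θ ∈ integrableExpSet X μ ∧ mgf X μ θ < Real.exp (θ * b) := by
  have hderiv : HasDerivAt (fun θ => mgf X μ θ - Real.exp (θ * b)) (μ[X] - b) 0 := by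
    simpa using (hasDerivAt_mgf hX).fun_sub ((hasDerivAt_mul_const b).exp)
  have slope_neg := ((hasDerivWithinAt_iff_tendsto_slope' (s := Set.Ioi 0) (by simp)).1
    hderiv.hasDerivWithinAt).eventually_lt_const (sub_neg.2 hb)
  have mem_integrableExpSet : ∀ᶠ θ in 𝓝[>] (0 : ℝ), θ ∈ integrableExpSet X μ :=
    nhdsWithin_le_nhds (mem_interior_iff_mem_nhds.1 hX)
  obtain ⟨θ, ⟨hslope, hmem⟩, hpos : 0 < θ⟩ :=
    ((slope_neg.and mem_integrableExpSet).and self_mem_nhdsWithin).exists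
  refine ⟨θ, hpos, hmem, ?_⟩
  rw [slope_def_field, div_lt_iff₀ (by simpa using hpos)] at hslope
  simpa using hslope

section IndependentProduct

variable {Ω : Type*} [MeasurableSpace Ω] {μ : Measure Ω} {f g : Ω → ℝ} (hfg : IndepFun f g μ)
  (hf : MemLp f 2 μ) (hg : MemLp g 2 μ)

include hfg hf hg

theorem memLp_two_mul_of_indepFun : MemLp (fun ω => f ω * g ω) 2 μ := by
  refine (memLp_two_iff_integrable_sq (hf.1.fun_mul hg.1)).2 ?_
  simp_rw [mul_pow]
  exact (hfg.comp (measurable_id.pow_const 2) (measurable_id.pow_const 2)).integrable_mul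
    hf.integrable_sq hg.integrable_sq

theorem integral_sq_mul_of_indepFun :
    ∫ ω, (f ω * g ω) ^ 2 ∂μ = (∫ ω, f ω ^ 2 ∂μ) * ∫ ω, g ω ^ 2 ∂μ := by
  simp_rw [mul_pow]
  exact (hfg.comp (measurable_id.pow_const 2) (measurable_id.pow_const 2)
    ).integral_fun_mul_eq_mul_integral hf.integrable_sq.1 hg.integrable_sq.1

end IndependentProduct

section Past

variable {Ω : Type*} [mΩ : MeasurableSpace Ω] {μ : Measure Ω} {E : Type*} [MeasurableSpace E]
  {Y : ℕ → Ω → E} (hY : ∀ t, Measurable (Y t))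

/-- The information carried by the terms of the process `Y` strictly before time `t`: unlike for
`Filtration.natural`, `Y t` itself is not included. -/
def past : Filtration ℕ mΩ where
  seq t := ⨆ s ∈ Set.Iio t, MeasurableSpace.comap (Y s) inferInstance
  mono' _ _ h := biSup_mono fun _ hs => lt_of_lt_of_le hs h
  le' _ := iSup₂_le fun s _ => (hY s).comap_le

theorem measurable_past {s t : ℕ} (h : s < t) : Measurable[past hY t] (Y s) :=
  measurable_iff_comap_le.2 (le_biSup (fun s => MeasurableSpace.comap (Y s) inferInstance) h)

theorem measurable_past_backlog {len : E → ℕ} (hlen : Measurable len) (t : ℕ) :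
    Measurable[past hY t] fun ω => backlog (fun s => len (Y s ω)) t := by
  induction t with
  | zero => exact measurable_const
  | succ t ih =>
    exact ((ih.mono ((past hY).mono t.le_succ) le_rfl).add
      (hlen.comp (measurable_past hY t.lt_succ_self))).sub_const 1

variable (hind : iIndepFun Y μ)

include hind

theorem indepFun_of_measurable_past {F : Type*} [MeasurableSpace F] {t : ℕ} {f : Ω → F}
    (hf : Measurable[past hY t] f) : IndepFun f (Y t) μ := by
  have hindep := indep_iSup_of_disjoint (fun s => (hY s).comap_le) hind
    (Set.disjoint_singleton_right.2 (lt_irrefl t) : Disjoint (Set.Iio t) {t})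
  rw [iSup_singleton] at hindep
  exact indep_of_indep_of_le_left hindep hf.comap_le

variable (hid : ∀ t, IdentDistrib (Y t) (Y 0) μ μ)

include hid

theorem ae_tendsto_average_past_mul {f : ℕ → Ω → ℝ} (hf : ∀ t, Measurable[past hY t] (f t))
    (hf2 : ∀ t, MemLp (f t) 2 μ) {C : ℝ} (hC : ∀ t, ∫ ω, f t ω ^ 2 ∂μ ≤ C) {ψ : E → ℝ}
    (hψ : Measurable ψ) (hψ2 : MemLp (fun ω => ψ (Y 0 ω)) 2 μ) (hψ0 : ∫ ω, ψ (Y 0 ω) ∂μ = 0) :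
    ∀ᵐ ω ∂μ, Tendsto (fun T : ℕ => (∑ t ∈ Finset.range T, f t ω * ψ (Y t ω)) / T) atTop
      (𝓝 0) := by
  have integral_ψ (t : ℕ) : ∫ ω, ψ (Y t ω) ∂μ = 0 := ((hid t).comp hψ).integral_eq.trans hψ0
  have memLp_ψ (t : ℕ) : MemLp (fun ω => ψ (Y t ω)) 2 μ := ((hid t).comp hψ).memLp_iff.2 hψ2
  have integral_ψ_sq (t : ℕ) : ∫ ω, ψ (Y t ω) ^ 2 ∂μ = ∫ ω, ψ (Y 0 ω) ^ 2 ∂μ :=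
    ((hid t).comp (hψ.pow_const 2)).integral_eq
  have indep_ψ {t : ℕ} {g : Ω → ℝ} (hg : Measurable[past hY t] g) :
      IndepFun g (fun ω => ψ (Y t ω)) μ :=
    (indepFun_of_measurable_past hY hind hg).comp measurable_id hψ
  refine ae_tendsto_average_of_orthogonal (C := C * ∫ ω, ψ (Y 0 ω) ^ 2 ∂μ)
    (fun t => memLp_two_mul_of_indepFun (indep_ψ (hf t)) (hf2 t) (memLp_ψ t))
    (fun s t hst => ?_) fun t => ?_
  · have hpast : Measurable[past hY t] fun ω => f s ω * ψ (Y s ω) * f t ω :=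
      (((hf s).mono ((past hY).mono hst.le) le_rfl).mul
        (hψ.comp (measurable_past hY hst))).mul (hf t)
    simp_rw [← mul_assoc]
    rw [(indep_ψ hpast).integral_fun_mul_eq_mul_integral
      (hpast.mono ((past hY).le t) le_rfl).aestronglyMeasurable (memLp_ψ t).1, integral_ψ,
      mul_zero]
  · rw [integral_sq_mul_of_indepFun (indep_ψ (hf t)) (hf2 t) (memLp_ψ t),
      integral_ψ_sq]
    gcongr
    exact hC t

end Past

theorem ae_tendsto_average_of_iIndepFun {Ω : Type*} [MeasurableSpace Ω] {μ : Measure Ω}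
    {E : Type*} [MeasurableSpace E] {Y : ℕ → Ω → E} (hind : iIndepFun Y μ)
    (hid : ∀ t, IdentDistrib (Y t) (Y 0) μ μ) {φ : E → ℝ} (hφ : Measurable φ)
    (hφ1 : Integrable (fun ω => φ (Y 0 ω)) μ) : ∀ᵐ ω ∂μ, Tendsto (fun T : ℕ =>
      (∑ t ∈ Finset.range T, φ (Y t ω)) / T) atTop (𝓝 (∫ ω, φ (Y 0 ω) ∂μ)) :=
  strong_law_ae_real (fun t ω => φ (Y t ω)) hφ1
    (fun _ _ hst => (hind.indepFun hst).comp hφ hφ) fun t => (hid t).comp hφ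

section MarkedQueue

variable {Ω : Type*} [MeasurableSpace Ω] {μ : Measure Ω} [IsProbabilityMeasure μ]
  {E : Type*} [MeasurableSpace E] {Y : ℕ → Ω → E} (hY : ∀ t, Measurable (Y t))
  (hind : iIndepFun Y μ) (hid : ∀ t, IdentDistrib (Y t) (Y 0) μ μ)
  {len : E → ℕ} (hlen : Measurable len)

include hY hind hid hlen

theorem integrable_exp_backlog_succ_and_mgf_le {θ : ℝ}
    (hθ : θ ∈ integrableExpSet (fun ω => (len (Y 0 ω) : ℝ)) μ) {t : ℕ}
    (hint : Integrable (fun ω => Real.exp (θ * backlog (fun s => len (Y s ω)) t)) μ) :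
    Integrable (fun ω => Real.exp (θ * backlog (fun s => len (Y s ω)) (t + 1))) μ ∧
      mgf (fun ω => (backlog (fun s => len (Y s ω)) (t + 1) : ℝ)) μ θ ≤
        Real.exp (-θ) * (mgf (fun ω => (backlog (fun s => len (Y s ω)) t : ℝ)) μ θ *
          mgf (fun ω => (len (Y 0 ω) : ℝ)) μ θ) + 1 := by
  have measurable_exp : Measurable fun n : ℕ => Real.exp (θ * n) := measurable_from_nat
  have hdist : IdentDistrib (fun ω => Real.exp (θ * len (Y t ω)))
      (fun ω => Real.exp (θ * len (Y 0 ω))) μ μ := (hid t).comp (measurable_exp.comp hlen)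
  have hindep : IndepFun (fun ω => Real.exp (θ * backlog (fun s => len (Y s ω)) t))
      (fun ω => Real.exp (θ * len (Y t ω))) μ :=
    (indepFun_of_measurable_past hY hind (measurable_past_backlog hY hlen t)).comp
      measurable_exp (measurable_exp.comp hlen)
  have hlen_int := hdist.integrable_iff.2 hθ
  have hprod : Integrable (fun ω => Real.exp (-θ) *
      (Real.exp (θ * backlog (fun s => len (Y s ω)) t) * Real.exp (θ * len (Y t ω)))) μ :=
    (hindep.integrable_mul hint hlen_int).const_mul _
  have hdom := hprod.add (integrable_const (1 : ℝ))
  have hle_dom (ω : Ω) := exp_backlog_succ_le (fun s => len (Y s ω)) θ t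
  have hint_succ : Integrable (fun ω => Real.exp (θ * backlog (fun s => len (Y s ω)) (t + 1))) μ :=
    hdom.mono' (measurable_exp.comp ((measurable_past_backlog hY hlen (t + 1)).mono
      ((past hY).le _) le_rfl)).aestronglyMeasurable
      (ae_of_all _ fun ω => by simpa using hle_dom ω)
  refine ⟨hint_succ, (integral_mono hint_succ hdom hle_dom).trans_eq ?_⟩
  simp only [Pi.add_apply]
  rw [integral_add hprod (integrable_const 1), integral_const_mul,
    hindep.integral_fun_mul_eq_mul_integral hint.1 hlen_int.1, hdist.integral_eq]
  simp [mgf]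

theorem integrable_exp_backlog_and_mgf_le {θ r : ℝ}
    (hθ : θ ∈ integrableExpSet (fun ω => (len (Y 0 ω) : ℝ)) μ)
    (hr : Real.exp (-θ) * mgf (fun ω => (len (Y 0 ω) : ℝ)) μ θ ≤ r) (hr1 : r < 1) (t : ℕ) :
    Integrable (fun ω => Real.exp (θ * backlog (fun s => len (Y s ω)) t)) μ ∧
      mgf (fun ω => (backlog (fun s => len (Y s ω)) t : ℝ)) μ θ ≤ (1 - r)⁻¹ := by
  have r_nonneg : 0 ≤ r := (mul_nonneg (Real.exp_nonneg _) mgf_nonneg).trans hr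
  induction t with
  | zero =>
    refine ⟨by simp [backlog], ?_⟩
    simpa [backlog, mgf] using (one_le_inv₀ (by linarith)).2 (by linarith : 1 - r ≤ 1)
  | succ t ih =>
    obtain ⟨hint, hle⟩ := ih
    obtain ⟨hint_succ, hle_succ⟩ :=
      integrable_exp_backlog_succ_and_mgf_le hY hind hid hlen hθ hint
    refine ⟨hint_succ, hle_succ.trans ?_⟩
    calc Real.exp (-θ) * (mgf (fun ω => (backlog (fun s => len (Y s ω)) t : ℝ)) μ θ *
          mgf (fun ω => (len (Y 0 ω) : ℝ)) μ θ) + 1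
        = mgf (fun ω => (backlog (fun s => len (Y s ω)) t : ℝ)) μ θ *
            (Real.exp (-θ) * mgf (fun ω => (len (Y 0 ω) : ℝ)) μ θ) + 1 := by ring
      _ ≤ (1 - r)⁻¹ * r + 1 := by
          gcongr
          exact mul_nonneg (Real.exp_nonneg _) mgf_nonneg
      _ = (1 - r)⁻¹ := by
          have : 1 - r ≠ 0 := by linarith
          field_simp
          ring

variable (hexp : 0 ∈ interior (integrableExpSet (fun ω => (len (Y 0 ω) : ℝ)) μ))
  (hload : ∫ ω, (len (Y 0 ω) : ℝ) ∂μ < 1)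

include hexp hload

theorem exists_integral_backlog_pow_le : ∃ C : ℕ → ℝ, ∀ k t,
    Integrable (fun ω => (backlog (fun s => len (Y s ω)) t : ℝ) ^ k) μ ∧
      ∫ ω, (backlog (fun s => len (Y s ω)) t : ℝ) ^ k ∂μ ≤ C k := by
  obtain ⟨θ, hθ, hmem, hlt⟩ := exists_mgf_lt_exp_mul hexp hload
  have hr1 : Real.exp (-θ) * mgf (fun ω => (len (Y 0 ω) : ℝ)) μ θ < 1 := by
    rw [mul_one] at hlt
    rwa [Real.exp_neg, inv_mul_lt_one₀ (Real.exp_pos θ)]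
  set r := Real.exp (-θ) * mgf (fun ω => (len (Y 0 ω) : ℝ)) μ θ with hr
  refine ⟨fun k => k.factorial / θ ^ k * (1 - r)⁻¹, fun k t => ?_⟩
  obtain ⟨hint, hle⟩ := integrable_exp_backlog_and_mgf_le hY hind hid hlen hmem hr.ge hr1 t
  have hpow (ω : Ω) := pow_le_factorial_div_mul_exp hθ
    (Nat.cast_nonneg (backlog (fun s => len (Y s ω)) t)) k
  have hpow_int : Integrable (fun ω => (backlog (fun s => len (Y s ω)) t : ℝ) ^ k) μ :=
    (hint.const_mul _).mono' ((measurable_from_nat (f := fun n : ℕ => (n : ℝ) ^ k)).comp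
      ((measurable_past_backlog hY hlen t).mono ((past hY).le _) le_rfl)).aestronglyMeasurable
      (ae_of_all _ fun ω => by simpa using hpow ω)
  refine ⟨hpow_int, (integral_mono hpow_int (hint.const_mul _) hpow).trans ?_⟩
  rw [integral_const_mul]
  exact mul_le_mul_of_nonneg_left hle (by positivity)

theorem ae_tendsto_sq_add_backlog_div : ∀ᵐ ω ∂μ, Tendsto (fun T : ℕ =>
    ((backlog (fun s => len (Y s ω)) T : ℝ) ^ 2 + backlog (fun s => len (Y s ω)) T) / T) atTop
      (𝓝 0) := by
  obtain ⟨C, hC⟩ := exists_integral_backlog_pow_le hY hind hid hlen hexp hload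
  have sq_div := ae_tendsto_zero_of_integral_sq_le (μ := μ) (C := C 4)
    (f := fun T ω => (backlog (fun s => len (Y s ω)) T : ℝ) ^ 2 / T)
    (fun T => by
      refine (memLp_two_iff_integrable_sq ((hC 2 T).1.div_const _).1).2 ?_
      simpa only [div_pow, ← pow_mul] using (hC 4 T).1.div_const _)
    fun T => by
      simp only [div_pow, ← pow_mul, integral_div]
      gcongr
      exact (hC 4 T).2
  filter_upwards [sq_div] with ω hω
  refine squeeze_zero (fun T => by positivity) (fun T => ?_) (by simpa using hω.const_mul 2)
  rw [← mul_div_assoc]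
  have : (backlog (fun s => len (Y s ω)) T : ℝ) ≤ backlog (fun s => len (Y s ω)) T ^ 2 := by
    exact_mod_cast Nat.le_self_pow two_ne_zero _
  gcongr
  linarith

theorem ae_tendsto_average_backlog_mul_centered {ψ : E → ℝ} (hψ : Measurable ψ)
    (hψ2 : MemLp (fun ω => ψ (Y 0 ω)) 2 μ) (hψ0 : ∫ ω, ψ (Y 0 ω) ∂μ = 0) :
    ∀ᵐ ω ∂μ, Tendsto (fun T : ℕ =>
      (∑ t ∈ Finset.range T, backlog (fun s => len (Y s ω)) t * ψ (Y t ω)) / T) atTop (𝓝 0) := by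
  obtain ⟨C, hC⟩ := exists_integral_backlog_pow_le hY hind hid hlen hexp hload
  have hmeas (t : ℕ) : Measurable[past hY t] fun ω => (backlog (fun s => len (Y s ω)) t : ℝ) :=
    (measurable_from_nat (f := fun n : ℕ => (n : ℝ))).comp (measurable_past_backlog hY hlen t)
  exact ae_tendsto_average_past_mul hY hind hid hmeas
    (fun t => (memLp_two_iff_integrable_sq
      ((hmeas t).mono ((past hY).le t) le_rfl).aestronglyMeasurable).2 (hC 2 t).1)
    (fun t => (hC 2 t).2) hψ hψ2 hψ0

/-- The mean backlog of the stationary queue in terms of the mean and the mean square of the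
work `S` arriving per slot. -/
noncomputable def meanBacklog (μ : Measure Ω) (S : Ω → ℕ) : ℝ :=
  (∫ ω, (S ω : ℝ) ^ 2 ∂μ - ∫ ω, (S ω : ℝ) ∂μ) / (2 * (1 - ∫ ω, (S ω : ℝ) ∂μ))

theorem ae_tendsto_average_backlog : ∀ᵐ ω ∂μ, Tendsto (fun T : ℕ =>
    (∑ t ∈ Finset.range T, (backlog (fun s => len (Y s ω)) t : ℝ)) / T) atTop
      (𝓝 (meanBacklog μ fun ω => len (Y 0 ω))) := by
  have cast_len : Measurable fun y => (len y : ℝ) := measurable_from_nat.comp hlen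
  have len_memLp : MemLp (fun ω => (len (Y 0 ω) : ℝ)) 2 μ :=
    memLp_of_mem_interior_integrableExpSet hexp 2
  have len_int := len_memLp.integrable one_le_two
  set m := ∫ ω, (len (Y 0 ω) : ℝ) ∂μ with hm
  have centered := ae_tendsto_average_backlog_mul_centered hY hind hid hlen hexp hload
    (cast_len.sub_const m) (len_memLp.sub (memLp_const m))
    (by rw [integral_sub len_int (integrable_const m)]; simp [m])
  have marks := ae_tendsto_average_of_iIndepFun hind hid ((cast_len.pow_const 2).sub cast_len)
    (len_memLp.integrable_sq.sub len_int)
  filter_upwards [ae_tendsto_sq_add_backlog_div hY hind hid hlen hexp hload, centered, marks]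
    with ω hsq hcentered hmarks
  have := ((hcentered.const_mul 2).add hmarks |>.sub hsq).div_const (2 * (1 - m))
  rw [meanBacklog, ← hm]
  simp only [Pi.sub_apply] at this
  rw [integral_sub len_memLp.integrable_sq len_int, mul_zero, zero_add, sub_zero] at this
  refine this.congr fun T => ?_
  have h2 : 2 * (1 - m) ≠ 0 := by linarith
  rw [sq_add_backlog_eq_sum, div_eq_iff h2, ← mul_div_assoc, ← add_div, ← sub_div,
    div_mul_eq_mul_div, Finset.mul_sum, ← Finset.sum_add_distrib, ← Finset.sum_sub_distrib,
    Finset.sum_mul]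
  congr 1
  exact Finset.sum_congr rfl fun t _ => by ring

theorem ae_tendsto_average_backlog_mul {φ : E → ℝ} (hφ : Measurable φ)
    (hφ2 : MemLp (fun ω => φ (Y 0 ω)) 2 μ) : ∀ᵐ ω ∂μ, Tendsto (fun T : ℕ =>
      (∑ t ∈ Finset.range T, backlog (fun s => len (Y s ω)) t * φ (Y t ω)) / T) atTop
      (𝓝 ((meanBacklog μ fun ω => len (Y 0 ω)) * ∫ ω, φ (Y 0 ω) ∂μ)) := by
  set m := ∫ ω, φ (Y 0 ω) ∂μ
  have centered := ae_tendsto_average_backlog_mul_centered hY hind hid hlen hexp hload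
    (hφ.sub_const m) (hφ2.sub (memLp_const m))
    (by rw [integral_sub (hφ2.integrable one_le_two) (integrable_const m)]; simp [m])
  filter_upwards [centered, ae_tendsto_average_backlog hY hind hid hlen hexp hload]
    with ω hcentered hbacklog
  have := hcentered.add (hbacklog.mul_const m)
  rw [zero_add] at this
  refine this.congr fun T => ?_
  rw [div_mul_eq_mul_div, ← add_div, Finset.sum_mul, ← Finset.sum_add_distrib]
  congr 1
  exact Finset.sum_congr rfl fun t _ => by ring

end MarkedQueue

section LawOfMarks

variable {Ω : Type*} [MeasurableSpace Ω] {μ : Measure Ω}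
  {E F : Type*} [MeasurableSpace E] [MeasurableSpace F]

theorem iIndepFun_prodMk {ι : Type*} {f : ι → Ω → E} {g : ι → Ω → F}
    (hf : ∀ i, Measurable (f i)) (hg : ∀ i, Measurable (g i)) (hf_indep : iIndepFun f μ)
    (hg_indep : iIndepFun g μ)
    (hfg : IndepFun (fun ω i => f i ω) (fun ω i => g i ω) μ) :
    iIndepFun (fun i ω => (f i ω, g i ω)) μ := by
  let rectangles (i : ι) : Set (Set Ω) := Set.preimage (fun ω => (f i ω, g i ω)) ''
    Set.image2 (· ×ˢ ·) {s : Set E | MeasurableSet s} {t : Set F | MeasurableSet t}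
  refine (iIndepFun_iff_iIndep _ _ _).2 (iIndepSets.iIndep
    (fun i => ((hf i).prodMk (hg i)).comap_le) rectangles (fun i => isPiSystem_prod.comap _)
    (fun i => by rw [← generateFrom_prod, MeasurableSpace.comap_generateFrom]) ?_)
  refine (iIndepSets_iff _ _).2 fun S A hA => ?_
  simp only [rectangles, Set.mem_image, Set.exists_mem_image2, Set.mem_ofPred_eq] at hA
  choose! s hs t ht hA using hA
  replace hA (i : ι) (hi : i ∈ S) : A i = f i ⁻¹' s i ∩ g i ⁻¹' t i := (hA i hi).symm
  have inter_eq : ⋂ i ∈ S, A i = (fun ω i => f i ω) ⁻¹' (Set.pi S s) ∩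
      (fun ω i => g i ω) ⁻¹' (Set.pi S t) := by
    ext ω
    simp only [Set.mem_iInter, Set.mem_inter_iff, Set.mem_preimage, Set.mem_pi, Finset.mem_coe,
      ← forall₂_and]
    exact forall₂_congr fun i hi => by rw [hA i hi]; rfl
  rw [inter_eq, hfg.measure_inter_preimage_eq_mul _ _
    (.pi S.countable_toSet hs) (.pi S.countable_toSet ht)]
  simp only [Set.pi_def, Set.preimage_iInter, Finset.mem_coe]
  calc μ (⋂ i ∈ S, f i ⁻¹' s i) * μ (⋂ i ∈ S, g i ⁻¹' t i)
      = ∏ i ∈ S, μ (f i ⁻¹' s i) * μ (g i ⁻¹' t i) := by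
        rw [hf_indep.measure_inter_preimage_eq_mul S hs,
          hg_indep.measure_inter_preimage_eq_mul S ht, Finset.prod_mul_distrib]
    _ = ∏ i ∈ S, μ (A i) := Finset.prod_congr rfl fun i hi => by
        rw [hA i hi]
        exact ((hfg.comp (measurable_pi_apply i)
          (measurable_pi_apply i)).measure_inter_preimage_eq_mul _ _ (hs i hi) (ht i hi)).symm

theorem iIndepFun_of_identDistrib [IsProbabilityMeasure μ] {ι : Type*} {Y Z : ι → Ω → E}
    (h : IdentDistrib (fun ω i => Y i ω) (fun ω i => Z i ω) μ μ) (hZ : iIndepFun Z μ) :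
    iIndepFun Y μ := by
  have marginal (i : ι) : μ.map (Y i) = μ.map (Z i) := (h.comp (measurable_pi_apply i)).map_eq
  rw [iIndepFun_iff_map_fun_eq_infinitePi_map₀ h.aemeasurable_fst, h.map_eq,
    hZ.map_fun_eq_infinitePi_map₀ h.aemeasurable_snd]
  simp only [marginal]

theorem measurable_eval_prod {ι : Type*} [Countable ι] [MeasurableSpace ι]
    [MeasurableSingletonClass ι] : Measurable fun p : ι × (ι → E) => p.2 p.1 :=
  measurable_from_prod_countable_right fun i => measurable_pi_apply i

theorem measurePreserving_reindex {α ι κ : Type*} [MeasurableSpace α] [Countable ι]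
    [MeasurableSpace ι] [MeasurableSingletonClass ι] (ρ : Measure α) [SFinite ρ] (ν : Measure E)
    [IsProbabilityMeasure ν] {φ : α → κ → ι} (hφ : ∀ k, Measurable fun a => φ a k)
    (hinj : ∀ a, Function.Injective (φ a)) :
    MeasurePreserving (fun p : α × (ι → E) => (p.1, fun k => p.2 (φ p.1 k)))
      (ρ.prod (Measure.infinitePi fun _ => ν)) (ρ.prod (Measure.infinitePi fun _ => ν)) := by
  have sample_measurable (k : κ) : Measurable fun p : α × (ι → E) => p.2 (φ p.1 k) :=
    measurable_eval_prod.comp (((hφ k).comp measurable_fst).prodMk measurable_snd)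
  exact (MeasurePreserving.id ρ).skew_product (g := fun a (z : ι → E) k => z (φ a k))
    (measurable_pi_iff.2 sample_measurable)
    (ae_of_all _ fun a => Measure.map_infinitePi_infinitePi_of_inj (hinj a))

theorem measurable_numArrivals (t : ℕ) : Measurable fun a : ℕ → Bool => numArrivals a t := by
  induction t with
  | zero => simpa only [numArrivals_zero] using measurable_const
  | succ t ih =>
    have arrival : MeasurableSet {a : ℕ → Bool | Arrival a (t + 1)} := by
      simpa [Arrival] using measurableSet_eq_fun (measurable_pi_apply (t + 1)) measurable_const
    simp only [numArrivals_succ]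
    exact ih.add (measurable_const.ite arrival measurable_const)

/-- The index of the source symbol used in slot `s + 1`: the next symbol of the source if the slot
is active, and a dummy symbol of its own, from a second copy of the source, otherwise. Thus no
symbol is used twice, whatever the arrivals. -/
def sampleIndex (a : ℕ → Bool) (s : ℕ) : Bool × ℕ :=
  (a (s + 1), if a (s + 1) then numArrivals a s else s)

theorem measurable_sampleIndex (s : ℕ) : Measurable fun a => sampleIndex a s := by
  have active : MeasurableSet {a : ℕ → Bool | a (s + 1) = true} :=
    measurableSet_eq_fun (measurable_pi_apply (s + 1)) measurable_const
  exact (measurable_pi_apply (s + 1)).prodMk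
    ((measurable_numArrivals s).ite active measurable_const)

theorem sampleIndex_injective (a : ℕ → Bool) : Function.Injective (sampleIndex a) := by
  have numArrivals_lt {s t : ℕ} (hs : a (s + 1) = true) (hst : s < t) :
      numArrivals a s < numArrivals a t := by
    have mono : numArrivals a (s + 1) ≤ numArrivals a t := Nat.count_monotone _ (by omega)
    rw [numArrivals_succ, if_pos ⟨by omega, hs⟩] at mono
    omega
  intro s t hst
  obtain ⟨hactive, hindex⟩ := Prod.mk.inj hst
  rw [← hactive] at hindex
  split_ifs at hindex with hs
  · rcases lt_trichotomy s t with h | h | h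
    · exact absurd hindex (numArrivals_lt hs h).ne
    · exact h
    · exact absurd hindex (numArrivals_lt (hactive ▸ hs) h).ne'
  · exact hindex

variable {f : Bool × E → F} (hf : Measurable f)

include hf

theorem measurable_mark {φ : (ℕ → Bool) → ℕ → ℕ} (hφ : ∀ s, Measurable fun a => φ a s) :
    Measurable fun (p : (ℕ → Bool) × (ℕ → E)) s => f (p.1 (s + 1), p.2 (φ p.1 s)) := by
  have symbol_measurable (s : ℕ) : Measurable fun p : (ℕ → Bool) × (ℕ → E) => p.2 (φ p.1 s) :=
    measurable_eval_prod.comp (((hφ s).comp measurable_fst).prodMk measurable_snd)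
  exact measurable_pi_iff.2 fun s => hf.comp
    (((measurable_pi_apply (s + 1)).comp measurable_fst).prodMk (symbol_measurable s))

variable (hf_false : ∀ y z, f (false, y) = f (false, z))

include hf_false

theorem map_mark_numArrivals (ρ : Measure (ℕ → Bool)) [SFinite ρ] (ν : Measure E)
    [IsProbabilityMeasure ν] :
    (ρ.prod (Measure.infinitePi fun _ : ℕ => ν)).map
        (fun p s => f (p.1 (s + 1), p.2 (numArrivals p.1 s))) =
      (ρ.prod (Measure.infinitePi fun _ : ℕ => ν)).map (fun p s => f (p.1 (s + 1), p.2 s)) := by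
  have first_copy := measurePreserving_reindex ρ ν (φ := fun _ (k : ℕ) => (true, k))
    (fun _ => measurable_const) fun _ => Prod.mk_right_injective true
  have resampled := measurePreserving_reindex ρ ν measurable_sampleIndex sampleIndex_injective
  have pathwise_eq (p : (ℕ → Bool) × (Bool × ℕ → E)) (s : ℕ) :
      f (p.1 (s + 1), p.2 (true, numArrivals p.1 s)) =
        f (p.1 (s + 1), p.2 (sampleIndex p.1 s)) := by
    rw [sampleIndex]
    cases p.1 (s + 1)
    · exact hf_false _ _
    · rfl
  nth_rw 1 [← first_copy.map_eq]
  rw [← resampled.map_eq,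
    Measure.map_map (measurable_mark hf measurable_numArrivals) first_copy.measurable,
    Measure.map_map (measurable_mark hf (φ := fun _ s => s) fun _ => measurable_const)
      resampled.measurable]
  congr 1
  exact funext₂ pathwise_eq

variable [IsProbabilityMeasure μ] {A : ℕ → Ω → Bool} {X : ℕ → Ω → E}
  (hA : ∀ t, Measurable (A t)) (hX : ∀ k, Measurable (X k)) (hX_indep : iIndepFun X μ)
  (hX_id : ∀ k, IdentDistrib (X k) (X 0) μ μ)
  (hAX : IndepFun (fun ω t => A t ω) (fun ω k => X k ω) μ)

include hA hX hX_indep hX_id hAX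

theorem identDistrib_mark_numArrivals :
    IdentDistrib (fun ω s => f (A (s + 1) ω, X (numArrivals (fun t => A t ω) s) ω))
      (fun ω s => f (A (s + 1) ω, X s ω)) μ μ := by
  have hA' : Measurable fun ω t => A t ω := measurable_pi_iff.2 hA
  have hX' : Measurable fun ω k => X k ω := measurable_pi_iff.2 hX
  have := Measure.isProbabilityMeasure_map (μ := μ) (hX 0).aemeasurable
  have := Measure.isProbabilityMeasure_map (μ := μ) hA'.aemeasurable
  have joint_law : μ.map (fun ω => (fun t => A t ω, fun k => X k ω)) =
      (μ.map fun ω t => A t ω).prod (Measure.infinitePi fun _ : ℕ => μ.map (X 0)) := by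
    rw [(indepFun_iff_map_prod_eq_prod_map_map hA'.aemeasurable hX'.aemeasurable).1 hAX,
      hX_indep.map_fun_eq_infinitePi_map hX]
    simp only [(hX_id _).map_eq]
  have sampled := measurable_mark hf measurable_numArrivals
  have unsampled := measurable_mark hf (φ := fun _ s => s) fun _ => measurable_const
  refine ⟨(sampled.comp (hA'.prodMk hX')).aemeasurable,
    (unsampled.comp (hA'.prodMk hX')).aemeasurable, ?_⟩
  have law_eq := map_mark_numArrivals hf hf_false (μ.map fun ω t => A t ω) (μ.map (X 0))
  rwa [← joint_law, Measure.map_map sampled (hA'.prodMk hX'),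
    Measure.map_map unsampled (hA'.prodMk hX')] at law_eq

theorem iIndepFun_mark_numArrivals (hA_indep : iIndepFun A μ) :
    iIndepFun (fun s ω => f (A (s + 1) ω, X (numArrivals (fun t => A t ω) s) ω)) μ := by
  have law := identDistrib_mark_numArrivals hf hf_false hA hX hX_indep hX_id hAX
  have unsampled_indep : iIndepFun (fun s ω => f (A (s + 1) ω, X s ω)) μ :=
    (iIndepFun_prodMk (fun s => hA (s + 1)) hX (hA_indep.precomp (add_left_injective 1)) hX_indep
      (hAX.comp (φ := fun a s => a (s + 1)) (ψ := id)
        (measurable_pi_iff.2 fun s => measurable_pi_apply _) measurable_id)).comp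
      (fun _ => f) fun _ => hf
  exact iIndepFun_of_identDistrib law unsampled_indep

theorem identDistrib_mark_numArrivals_apply (hA_id : ∀ t, IdentDistrib (A t) (A 0) μ μ) (s : ℕ) :
    IdentDistrib (fun ω => f (A (s + 1) ω, X (numArrivals (fun t => A t ω) s) ω))
      (fun ω => f (A 0 ω, X 0 ω)) μ μ := by
  have symbol_indep (t k : ℕ) : IndepFun (A t) (X k) μ :=
    hAX.comp (measurable_pi_apply t) (measurable_pi_apply k)
  exact ((identDistrib_mark_numArrivals hf hf_false hA hX hX_indep hX_id hAX).comp
    (measurable_pi_apply s)).trans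
    (((hA_id (s + 1)).prodMk (hX_id s) (symbol_indep _ _) (symbol_indep 0 0)).comp hf)

end LawOfMarks

section SlotMark

variable {𝒳 : Type*} (c : 𝒳 → List Bool)

/-- What a slot with activity `p.1` and source symbol `p.2` contributes to the queue: the activity
itself and the number of bits that are appended to the buffer. -/
def mark (p : Bool × 𝒳) : Bool × ℕ :=
  (p.1, p.1.toNat * (c p.2).length)

/-- The mark of slot `t + 1`, in which the symbol sent, if any, is `x (numArrivals a t)`. -/
def slotMark (a : ℕ → Bool) (x : ℕ → 𝒳) (t : ℕ) : Bool × ℕ :=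
  mark c (a (t + 1), x (numArrivals a t))

variable (a : ℕ → Bool) (x : ℕ → 𝒳)

theorem ite_arrival_eq_toNat_mul (t : ℕ) (r : ℝ) :
    (if Arrival a (t + 1) then r else 0) = (a (t + 1)).toNat * r := by
  cases h : a (t + 1) <;> simp [Arrival, h]

theorem numArrivals_eq_sum (T : ℕ) :
    (numArrivals a T : ℝ) = ∑ t ∈ Finset.range T, ((a (t + 1)).toNat : ℝ) := by
  simpa [ite_arrival_eq_toNat_mul] using (sum_ite_arrival a (fun _ => 1) T).symm

theorem length_buffer_succ_eq_backlog (t : ℕ) : (buffer c a x (t + 1)).length =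
    backlog (fun s => (slotMark c a x s).2) t + (slotMark c a x t).2 := by
  have appended : (if Arrival a (t + 1) then (c (x (numArrivals a t))).length else 0) =
      (slotMark c a x t).2 := by
    cases h : a (t + 1) <;> simp [Arrival, slotMark, mark, h]
  have backlog_eq : (buffer c a x t).length - 1 = backlog (fun s => (slotMark c a x s).2) t := by
    cases t with
    | zero => rfl
    | succ t => rw [length_buffer_succ_eq_backlog t, backlog]
  rw [length_buffer_succ, appended, backlog_eq]

theorem sum_length_buffer_arrival (T : ℕ) :
    (∑ t ∈ Finset.range T, if Arrival a (t + 1) then ((buffer c a x (t + 1)).length : ℝ) else 0) =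
      ∑ t ∈ Finset.range T, (backlog (fun s => (slotMark c a x s).2) t : ℝ) *
          (slotMark c a x t).1.toNat +
        ∑ t ∈ Finset.range T, ((slotMark c a x t).2 : ℝ) := by
  rw [← Finset.sum_add_distrib]
  refine Finset.sum_congr rfl fun t _ => ?_
  rw [ite_arrival_eq_toNat_mul, length_buffer_succ_eq_backlog, slotMark, mark]
  cases a (t + 1) <;> simp

end SlotMark

section Laws

variable {Ω : Type*} [MeasurableSpace Ω] {μ : Measure Ω}

theorem identDistrib_of_forall_measure_eq {ι E : Type*} [MeasurableSpace E] [Countable E]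
    [MeasurableSingletonClass E] {X : ι → Ω → E} (hX : ∀ i, Measurable (X i)) {p : E → ENNReal}
    (hX_law : ∀ i x, μ {ω | X i ω = x} = p x) (i j : ι) : IdentDistrib (X i) (X j) μ μ := by
  refine ⟨(hX i).aemeasurable, (hX j).aemeasurable, Measure.ext_of_singleton fun x => ?_⟩
  rw [Measure.map_apply (hX i) (measurableSet_singleton x),
    Measure.map_apply (hX j) (measurableSet_singleton x)]
  exact (hX_law i x).trans (hX_law j x).symm

theorem identDistrib_of_forall_measureReal_true_eq [IsProbabilityMeasure μ] {ι : Type*}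
    {A : ι → Ω → Bool} (hA : ∀ i, Measurable (A i)) {q : ℝ}
    (hA_law : ∀ i, μ.real {ω | A i ω = true} = q) (i j : ι) : IdentDistrib (A i) (A j) μ μ := by
  have measure_true (i : ι) : μ {ω | A i ω = true} = ENNReal.ofReal q := by
    rw [← hA_law i, ofReal_measureReal]
  have measure_false (i : ι) : μ {ω | A i ω = false} = 1 - ENNReal.ofReal q := by
    have active_measurable : MeasurableSet {ω | A i ω = true} :=
      hA i (measurableSet_singleton true)
    rw [← measure_true i, ← prob_compl_eq_one_sub active_measurable]
    congr 1
    ext ω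
    simp
  exact identDistrib_of_forall_measure_eq hA
    (p := fun b => if b then ENNReal.ofReal q else 1 - ENNReal.ofReal q)
    (fun i b => by cases b <;> simp [measure_true, measure_false]) i j

theorem integral_toNat {B : Ω → Bool} (hB : Measurable B) :
    ∫ ω, ((B ω).toNat : ℝ) ∂μ = μ.real {ω | B ω = true} := by
  have active_measurable : MeasurableSet {ω | B ω = true} := hB (measurableSet_singleton true)
  rw [← integral_indicator_one active_measurable]
  congr 1
  ext ω
  cases h : B ω <;> simp [Set.indicator, h]

theorem integral_comp_eq_sum {E : Type*} [Fintype E] [MeasurableSpace E]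
    [MeasurableSingletonClass E] [IsFiniteMeasure μ] {Z : Ω → E} (hZ : Measurable Z)
    (g : E → ℝ) : ∫ ω, g (Z ω) ∂μ = ∑ x, μ.real {ω | Z ω = x} * g x := by
  rw [← integral_map hZ.aemeasurable (measurable_of_finite g).aestronglyMeasurable,
    integral_fintype .of_finite]
  refine Finset.sum_congr rfl fun x _ => ?_
  rw [map_measureReal_apply hZ (measurableSet_singleton x)]
  rfl

theorem integrable_comp_of_finite {E : Type*} [Finite E] [MeasurableSpace E]
    [MeasurableSingletonClass E] [IsFiniteMeasure μ] {Z : Ω → E} (hZ : Measurable Z)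
    (g : E → ℝ) : Integrable (fun ω => g (Z ω)) μ :=
  (integrable_map_measure (measurable_of_finite g).aestronglyMeasurable hZ.aemeasurable).1
    .of_finite

end Laws

section StreamingSystem

variable {Ω : Type*} [MeasurableSpace Ω] {μ : Measure Ω} [IsProbabilityMeasure μ]
  {𝒳 : Type*} [MeasurableSpace 𝒳] [MeasurableSingletonClass 𝒳]
  {q : ℝ} {P : PMF 𝒳} (c : 𝒳 → List Bool)

theorem integral_mark_pow [Fintype 𝒳] {B : Ω → Bool} {Z : Ω → 𝒳} (hB : Measurable B)
    (hZ : Measurable Z) (hZ_law : ∀ x, μ {ω | Z ω = x} = P x)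
    (hBZ : IndepFun B Z μ) {m : ℕ} (hm : m ≠ 0) :
    ∫ ω, ((mark c (B ω, Z ω)).2 : ℝ) ^ m ∂μ =
      μ.real {ω | B ω = true} * lengthMoment P c m := by
  have toNat_measurable : Measurable fun b : Bool => (b.toNat : ℝ) := measurable_of_finite _
  have pow_measurable : Measurable fun y : 𝒳 => ((c y).length : ℝ) ^ m := measurable_of_finite _
  have mark_pow (ω : Ω) : ((mark c (B ω, Z ω)).2 : ℝ) ^ m =
      (B ω).toNat * ((c (Z ω)).length : ℝ) ^ m := by
    cases h : B ω <;> simp [mark, hm]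
  have moment_factors := (hBZ.comp toNat_measurable pow_measurable).integral_fun_mul_eq_mul_integral
    (toNat_measurable.comp hB).aestronglyMeasurable (pow_measurable.comp hZ).aestronglyMeasurable
  simp only [Function.comp] at moment_factors
  simp only [mark_pow]
  rw [moment_factors, integral_toNat hB, integral_comp_eq_sum hZ fun y => ((c y).length : ℝ) ^ m]
  simp only [lengthMoment, measureReal_def, hZ_law]

theorem ae_tendsto_numArrivals_div {A : ℕ → Ω → Bool} (hA : ∀ t, Measurable (A t))
    (hA_law : ∀ t, μ.real {ω | A t ω = true} = q) (hA_indep : iIndepFun A μ) :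
    ∀ᵐ ω ∂μ, Tendsto (fun T : ℕ => (numArrivals (A · ω) T : ℝ) / T) atTop (𝓝 q) := by
  have slln := ae_tendsto_average_of_iIndepFun (Y := fun t => A (t + 1))
    (φ := fun b => (b.toNat : ℝ)) (hA_indep.precomp (add_left_injective 1))
    (fun t => identDistrib_of_forall_measureReal_true_eq hA hA_law (t + 1) (0 + 1))
    (measurable_of_finite _) (integrable_comp_of_finite (hA (0 + 1)) fun b => (b.toNat : ℝ))
  rw [integral_toNat (hA (0 + 1)), hA_law] at slln
  simpa only [numArrivals_eq_sum] using slln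

variable {A : ℕ → Ω → Bool} {X : ℕ → Ω → 𝒳} (hA : ∀ t, Measurable (A t))
  (hX : ∀ k, Measurable (X k))

include hA hX

theorem measurable_slotMark [Countable 𝒳] (t : ℕ) :
    Measurable fun ω => slotMark c (A · ω) (X · ω) t := by
  have hmark := measurable_mark (Measurable.of_discrete (f := mark c)) measurable_numArrivals
  exact (measurable_pi_iff.1 hmark t).comp
    ((measurable_pi_iff.2 hA).prodMk (measurable_pi_iff.2 hX))

variable (hX_law : ∀ k x, μ {ω | X k ω = x} = P x) (hX_indep : iIndepFun X μ)
  (hAX : IndepFun (fun ω t => A t ω) (fun ω k => X k ω) μ)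

include hX_law hX_indep hAX

theorem iIndepFun_slotMark [Countable 𝒳] (hA_indep : iIndepFun A μ) :
    iIndepFun (fun t ω => slotMark c (A · ω) (X · ω) t) μ :=
  iIndepFun_mark_numArrivals .of_discrete (by simp [mark]) hA hX hX_indep
    (identDistrib_of_forall_measure_eq hX hX_law · 0) hAX hA_indep

variable (hA_law : ∀ t, μ.real {ω | A t ω = true} = q)

include hA_law

theorem identDistrib_slotMark [Countable 𝒳] (t : ℕ) :
    IdentDistrib (fun ω => slotMark c (A · ω) (X · ω) t) (fun ω => mark c (A 0 ω, X 0 ω)) μ μ :=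
  identDistrib_mark_numArrivals_apply .of_discrete (by simp [mark]) hA hX hX_indep
    (identDistrib_of_forall_measure_eq hX hX_law · 0) hAX
    (identDistrib_of_forall_measureReal_true_eq hA hA_law · 0) t

theorem integrable_comp_slotMark [Finite 𝒳] (t : ℕ) (g : Bool × ℕ → ℝ) :
    Integrable (fun ω => g (slotMark c (A · ω) (X · ω) t)) μ :=
  ((identDistrib_slotMark c hA hX hX_law hX_indep hAX hA_law t).comp
    (Measurable.of_discrete (f := g))).integrable_iff.2
    (integrable_comp_of_finite ((hA 0).prodMk (hX 0)) fun p => g (mark c p))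

theorem integral_comp_slotMark [Countable 𝒳] (t : ℕ) (g : Bool × ℕ → ℝ) :
    ∫ ω, g (slotMark c (A · ω) (X · ω) t) ∂μ = ∫ ω, g (mark c (A 0 ω, X 0 ω)) ∂μ :=
  ((identDistrib_slotMark c hA hX hX_law hX_indep hAX hA_law t).comp
    (Measurable.of_discrete (f := g))).integral_eq

theorem integral_slotMark_fst_toNat [Countable 𝒳] (t : ℕ) :
    ∫ ω, ((slotMark c (A · ω) (X · ω) t).1.toNat : ℝ) ∂μ = q := by
  rw [integral_comp_slotMark c hA hX hX_law hX_indep hAX hA_law t fun y => (y.1.toNat : ℝ),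
    ← hA_law 0, ← integral_toNat (hA 0)]
  rfl

theorem integral_slotMark_snd_pow [Fintype 𝒳] (t : ℕ) {m : ℕ} (hm : m ≠ 0) :
    ∫ ω, ((slotMark c (A · ω) (X · ω) t).2 : ℝ) ^ m ∂μ = q * lengthMoment P c m := by
  rw [integral_comp_slotMark c hA hX hX_law hX_indep hAX hA_law t fun y => (y.2 : ℝ) ^ m,
    integral_mark_pow c (hA 0) (hX 0) (hX_law 0)
      (hAX.comp (measurable_pi_apply 0) (measurable_pi_apply 0)) hm, hA_law]

theorem ae_tendsto_average_length_buffer_arrival [Fintype 𝒳] (hA_indep : iIndepFun A μ)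
    (hstable : q * lengthMoment P c 1 < 1) :
    ∀ᵐ ω ∂μ, Tendsto (fun T : ℕ => (∑ t ∈ Finset.range T,
      if Arrival (A · ω) (t + 1) then ((buffer c (A · ω) (X · ω) (t + 1)).length : ℝ) else 0) / T)
      atTop (𝓝 ((q * lengthMoment P c 2 - q * lengthMoment P c 1) /
        (2 * (1 - q * lengthMoment P c 1)) * q + q * lengthMoment P c 1)) := by
  have hind := iIndepFun_slotMark c hA hX hX_law hX_indep hAX hA_indep
  have hid_mark := identDistrib_slotMark c hA hX hX_law hX_indep hAX hA_law
  have hid (t : ℕ) := (hid_mark t).trans (hid_mark 0).symm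
  have hY := measurable_slotMark c hA hX
  have hint := integrable_comp_slotMark c hA hX hX_law hX_indep hAX hA_law 0
  have second_moment :=
    integral_slotMark_snd_pow c hA hX hX_law hX_indep hAX hA_law 0 two_ne_zero
  have first_moment := integral_slotMark_snd_pow c hA hX hX_law hX_indep hAX hA_law 0 one_ne_zero
  simp only [pow_one] at first_moment
  have hexp : 0 ∈ interior
      (integrableExpSet (fun ω => ((slotMark c (A · ω) (X · ω) 0).2 : ℝ)) μ) := by
    have all_integrable : integrableExpSet _ μ = Set.univ :=
      Set.eq_univ_of_forall fun θ => hint fun y => Real.exp (θ * y.2)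
    simp only [all_integrable, interior_univ, Set.mem_univ]
  have hactive : Measurable fun y : Bool × ℕ => (y.1.toNat : ℝ) := .of_discrete
  have queued_bits := ae_tendsto_average_backlog_mul hY hind hid measurable_snd hexp
    (first_moment.trans_lt hstable) hactive
    ((memLp_two_iff_integrable_sq (hactive.comp (hY 0)).aestronglyMeasurable).2
      (hint fun y => (y.1.toNat : ℝ) ^ 2))
  have new_bits := ae_tendsto_average_of_iIndepFun hind hid
    (Measurable.of_discrete (f := fun y => (y.2 : ℝ))) (hint fun y => (y.2 : ℝ))
  filter_upwards [queued_bits, new_bits] with ω hqueued hnew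
  have := hqueued.add hnew
  rw [meanBacklog, second_moment, first_moment,
    integral_slotMark_fst_toNat c hA hX hX_law hX_indep hAX hA_law] at this
  refine this.congr fun T => ?_
  rw [sum_length_buffer_arrival, add_div]

end StreamingSystem

end StreamCoding

open StreamCoding in
theorem theorem1_general
    {Ω : Type*} [MeasurableSpace Ω] (μ : Measure Ω) [IsProbabilityMeasure μ]
    {𝒳 : Type*} [Fintype 𝒳] [MeasurableSpace 𝒳] [MeasurableSingletonClass 𝒳]
    (q : ℝ) (hq0 : 0 < q) (P : PMF 𝒳) (c : 𝒳 → List Bool) (hc : ∀ y z, c y = [] → c z = [])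
    (Δ₀ : ℝ) (hΔ₀ : 0 ≤ Δ₀)
    (active : ℕ → Ω → Bool) (hactive : ∀ t, Measurable (active t))
    (hactive_law : ∀ t, μ.real {ω | active t ω = true} = q)
    (hactive_indep : iIndepFun active μ)
    (X : ℕ → Ω → 𝒳) (hX : ∀ k, Measurable (X k))
    (hX_law : ∀ k x, μ {ω | X k ω = x} = P x)
    (hX_indep : iIndepFun X μ)
    (hindep : IndepFun (fun ω t => active t ω) (fun ω k => X k ω) μ)
    (hstable : lengthMoment P c 1 < 1 / q) :
    ∀ᵐ ω ∂μ,
      {n : ℕ | IsPeakTime Δ₀ c (fun t => active t ω) (fun k => X k ω) n}.Infinite ∧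
      Tendsto (fun K : ℕ => (1 / (K : ℝ)) * ∑ k ∈ Finset.range K,
          peakAge Δ₀ c (fun t => active t ω) (fun k => X k ω) k) atTop
        (𝓝 ((lengthMoment P c 2 - lengthMoment P c 1) / (2 * (1 / q - lengthMoment P c 1))
          + lengthMoment P c 1 + 1 / q)) := by
  have load_lt_one : q * lengthMoment P c 1 < 1 := by rwa [lt_div_iff₀' hq0] at hstable
  filter_upwards [ae_tendsto_numArrivals_div hactive hactive_law hactive_indep,
    ae_tendsto_average_length_buffer_arrival c hactive hX hX_law hX_indep hindep hactive_law
      hactive_indep load_lt_one] with ω hN hG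
  have ha := infinite_arrival_of_tendsto hq0 hN
  refine ⟨infinite_isPeakTime c _ ha hc hΔ₀, ?_⟩
  convert tendsto_average_peakAge c _ ha hc hΔ₀ hq0 hN hG using 2
  have : 1 - q * lengthMoment P c 1 ≠ 0 := (sub_pos.2 load_lt_one).ne'
  have : 1 / q - lengthMoment P c 1 ≠ 0 := (sub_pos.2 hstable).ne'
  field_simp

theorem theorem1
    {Ω : Type*} [MeasurableSpace Ω] (μ : MeasureTheory.Measure Ω)
    [MeasureTheory.IsProbabilityMeasure μ]
    {𝒳 : Type*} [Fintype 𝒳] [MeasurableSpace 𝒳] [MeasurableSingletonClass 𝒳]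
    (q : ℝ) (hq0 : 0 < q) (hq1 : q ≤ 1)
    (P : PMF 𝒳) (c : 𝒳 → List Bool) (hc : StreamCoding.PrefixFree c)
    (Δ₀ : ℝ) (hΔ₀ : 0 ≤ Δ₀)
    -- the Bernoulli(q) arrival process
    (active : ℕ → Ω → Bool) (hactive : ∀ t, Measurable (active t))
    (hactive_law : ∀ t, μ.real {ω | active t ω = true} = q)
    (hactive_indep : ProbabilityTheory.iIndepFun active μ)
    -- the i.i.d. source symbols
    (X : ℕ → Ω → 𝒳) (hX : ∀ k, Measurable (X k))
    (hX_law : ∀ k x, μ {ω | X k ω = x} = P x)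
    (hX_indep : ProbabilityTheory.iIndepFun X μ)
    -- symbols and arrivals are independent
    (hindep : ProbabilityTheory.IndepFun (fun ω t => active t ω) (fun ω k => X k ω) μ)
    -- stability
    (hstable : StreamCoding.lengthMoment P c 1 < 1 / q) :
    ∀ᵐ ω ∂μ,
      {n : ℕ | StreamCoding.IsPeakTime Δ₀ c (fun t => active t ω) (fun k => X k ω) n}.Infinite ∧
      Filter.Tendsto
        (fun K : ℕ => (1 / (K : ℝ)) * ∑ k ∈ Finset.range K,
          StreamCoding.peakAge Δ₀ c (fun t => active t ω) (fun k => X k ω) k)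
        Filter.atTop
        (nhds ((StreamCoding.lengthMoment P c 2 - StreamCoding.lengthMoment P c 1) /
            (2 * (1 / q - StreamCoding.lengthMoment P c 1))
          + StreamCoding.lengthMoment P c 1 + 1 / q)) :=
  theorem1_general μ q hq0 P c
    (fun y z hy => (hc y z (by rw [hy]; exact List.nil_prefix)) ▸ hy) Δ₀ hΔ₀
    active hactive hactive_law hactive_indep X hX hX_law hX_indep hindep hstable
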